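/- Let $T$ be a locally finite tree (a connected graph without cycles) rooted at a vertex $o$ which has exactly one neighbour; $T$ may have leaves. Every edge $\alpha$ is oriented away from $o$, with beginning vertex $b(\alpha)$ and ending vertex $e(\alpha)$. Let $\partial T$ be the set of half-infinite geodesics starting at $o$, together with the leaves. For a vertex or boundary point $x$ let $P(x)$ be the set of edges of the geodesic from $o$ to $x$, and for edges write $\alpha\le\beta$ if $\alpha\in P(e(\beta))$. For an edge $\alpha$, the tent $T_\alpha$ is the tree with edges $\{\beta:\beta\ge\alpha\}$, root vertex $b(\alpha)$ and boundary $\partial T_\alpha=\{\zeta\in\partial T:\alpha\in P(\zeta)\}$. The sets $\partial T_\alpha$ form a basis of the topology of $\partial T$. Fix $1<p<\infty$ and $1/p+1/p'=1$. For $f\ge 0$ on the edges put $If(x)=\sum_{\alpha\in P(x)}f(\alpha)\in[0,\infty]$. For an arbitrary set $E\subseteq\partial T$ let $\Omega_E=\{f\in\ell^p:\ f\ge0,\ If\ge1\text{ on }E\}$ and $c_p(E)=\inf_{f\in\Omega_E}\|f\|_p^p$; the $p$-equilibrium function of $E$ is the $f\in\overline{\Omega_E}^{\ell^p}$ with $\|f\|_p^p=c_p(E)$.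 For a finite positive Borel measure $\mu$ on $\partial T$ let $M(\alpha)=\mu(\partial T_\alpha)$ and $M_p=M^{p'-1}$. The measure $\mu$ is the $p$-equilibrium measure of $E$ if it is carried by $\overline E$, $M_p$ is the $p$-equilibrium function of $E$, and $\mu(\partial T)=c_p(E)$. The same notions for the tree $T_\alpha$ are obtained by using only the edges of $T_\alpha$ and the points of $\partial T_\alpha$; its capacity is denoted by $c_{p,\alpha}$. (1) Let $\mu$ be the $p$-equilibrium measure of $E\subseteq\partial T$. Then, for every edge $\alpha$, one has $IM_p(b(\alpha))<1$, and $$\mu_\alpha:=k_\alpha\,\mu|_{\partial T_\alpha}=\frac{\mu|_{\partial T_\alpha}}{\bigl(1-IM_p(b(\alpha))\bigr)^{p/p'}},\qquad k_\alpha:=\bigl(1-IM_p(b(\alpha))\bigr)^{-p/p'},$$ is the $p$-equilibrium measure of $E_\alpha:=E\cap\partial T_\alpha$ in the tree $T_\alpha$. If $\mu(\partial T\setminus E)=0$ (for instance if $E$ is closed), then also $\mu|_{\partial T_\alpha}=\mu|_{E_\alpha}$, so that $\mu_\alpha=k_\alpha\,\mu|_{E_\alpha}$. (2) Let $E\subseteq\partial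 T$ with $c_p(E)>0$, and let $\alpha$ be an edge other than the root edge such that $E\subseteq\partial T_\alpha$. Then $c_{p,\alpha}(E)>c_p(E)$. -/

import Mathlib

open MeasureTheory
open scoped ENNReal

namespace TreeCapacity

noncomputable section

/-! ### Rooted trees, their edges and their boundary -/

/-- `G` is a locally finite tree, rooted at a vertex `o` with exactly one neighbour. -/
structure IsRootedTree {V : Type*} (G : SimpleGraph V) (o : V) : Prop where
  isTree : G.IsTree
  locallyFinite : ∀ v : V, (G.neighborSet v).Finite
  root_neighbor : ∃! x : V, G.Adj o x

/-- The edges of the tree. An edge is recorded together with its orientation away from the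
root: `b` is its beginning vertex, `e` its ending vertex. In a tree every edge carries
exactly one such orientation. -/
@[ext]
structure Edge {V : Type*} (G : SimpleGraph V) (o : V) where
  b : V
  e : V
  adj : G.Adj b e
  outward : G.dist o e = G.dist o b + 1

variable {V : Type*} {G : SimpleGraph V} {o : V}

/-- The predecessor set `P(x)` of a vertex: the edges crossed by the geodesic from `o` to `x`. -/
def vertexPred (G : SimpleGraph V) (o x : V) : Set (Edge G o) :=
  {α | ∃ w : G.Walk o x, w.IsPath ∧ s(α.b, α.e) ∈ w.edges}

/-- `α ≤ β` if the geodesic which starts at the root and ends with `β` passes through `α`. -/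
instance : LE (Edge G o) := ⟨fun α β => α ∈ vertexPred G o β.e⟩

/-- An edge is a leaf if no other edge lies beyond it. -/
def Edge.IsLeaf (α : Edge G o) : Prop := ∀ β : Edge G o, α ≤ β → β = α

/-- The boundary of the tree: half-infinite geodesics starting from the root, and leaves. -/
inductive Boundary {V : Type*} (G : SimpleGraph V) (o : V) where
  | ray (r : ℕ → V) (start : r 0 = o) (adj : ∀ n, G.Adj (r n) (r (n + 1)))
      (inj : Function.Injective r) : Boundary G o
  | leaf (α : Edge G o) (isLeaf : α.IsLeaf) : Boundary G o

/-- The predecessor set `P(ζ)` of a boundary point. -/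
def Boundary.pred : Boundary G o → Set (Edge G o)
  | .ray r _ _ _ => {α | ∃ n, α.b = r n ∧ α.e = r (n + 1)}
  | .leaf α _ => vertexPred G o α.e

/-- The boundary `∂T_α` of the tent rooted in `α`, as a subset of `∂T`. -/
def tentBoundary (α : Edge G o) : Set (Boundary G o) := {ζ | α ∈ ζ.pred}

/-- The topology of `∂T`, generated by the boundaries of tents. -/
instance : TopologicalSpace (Boundary G o) :=
  TopologicalSpace.generateFrom (Set.range (tentBoundary (G := G) (o := o)))

instance : MeasurableSpace (Boundary G o) := borel _

instance : BorelSpace (Boundary G o) := ⟨rfl⟩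

/-- The edges `β ≥ α` of the tent `T_α`. -/
abbrev TentEdge (α : Edge G o) : Type _ := {β : Edge G o // α ≤ β}

/-- The predecessor set, inside the tent `T_α`, of a point of `∂T_α`. -/
def tentPred (α : Edge G o) (ζ : tentBoundary α) : Set (TentEdge α) :=
  {β | β.1 ∈ ζ.1.pred}

/-! ### Potential theory

The ambient tree enters through the set `ι` of its edges, its boundary `X`, and the map `P`
which sends a boundary point to its predecessor set. It is used for the whole tree,
`P = Boundary.pred`, and for a tent, `P = tentPred α`. -/

instance factOneLeOfReal {p : ℝ} [h : Fact (1 < p)] : Fact (1 ≤ ENNReal.ofReal p) :=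
  ⟨by rw [← ENNReal.ofReal_one]; exact ENNReal.ofReal_le_ofReal h.out.le⟩

/-- The space `ℓ^p` of `p`-summable real functions on the edges. -/
abbrev EdgeLp (ι : Type*) (p : ℝ) := lp (fun _ : ι => ℝ) (ENNReal.ofReal p)

/-- The potential `If` of a nonnegative edge function, at a vertex or boundary point with
predecessor set `S`: the sum of `f` over `S`, possibly infinite. -/
def potential {ι : Type*} (S : Set ι) (f : ι → ℝ) : ℝ≥0∞ := ∑' i : S, ENNReal.ofReal (f i)

/-- The set `Ω_E` of the nonnegative `ℓ^p` functions whose potential is at least `1` on `E`. -/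
def testFunctions {ι X : Type*} (P : X → Set ι) (p : ℝ) (E : Set X) : Set (EdgeLp ι p) :=
  {f | (∀ i, 0 ≤ f i) ∧ ∀ x ∈ E, 1 ≤ potential (P x) f}

variable {ι X : Type*}

/-- The `p`-capacity `c_p(E)`. -/
def capacity (P : X → Set ι) (p : ℝ) [Fact (1 < p)] (E : Set X) : ℝ≥0∞ :=
  ⨅ f ∈ testFunctions P p E, ‖f‖ₑ ^ p

/-- `f` is the `p`-equilibrium function of `E`: it is in the `ℓ^p`-closure of `Ω_E` and
`‖f‖_p^p = c_p(E)`. -/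
def IsEquilibriumFunction (P : X → Set ι) (p : ℝ) [Fact (1 < p)] (E : Set X)
    (f : EdgeLp ι p) : Prop :=
  f ∈ closure (testFunctions P p E) ∧ ‖f‖ₑ ^ p = capacity P p E

/-- The co-potential `M` of a measure: `M(α)` is the mass of the boundary of the tent `T_α`. -/
def copotential [MeasurableSpace X] (P : X → Set ι) (μ : Measure X) (i : ι) : ℝ :=
  μ.real {x | i ∈ P x}

/-- The edge function `M_p = M^{p'-1}` associated to a measure. -/
def edgeFunction [MeasurableSpace X] (P : X → Set ι) (p : ℝ) (μ : Measure X) (i : ι) : ℝ :=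
  copotential P μ i ^ (p.conjExponent - 1)

/-- `μ` is the `p`-equilibrium measure of `E`: a finite Borel measure carried by the closure
of `E`, whose edge function `M_p` is the `p`-equilibrium function of `E`, and whose total mass
is `c_p(E)`. -/
structure IsEquilibriumMeasure [TopologicalSpace X] [MeasurableSpace X] (P : X → Set ι)
    (p : ℝ) [Fact (1 < p)] (E : Set X) (μ : Measure X) : Prop where
  finite : IsFiniteMeasure μ
  carried : μ (closure E)ᶜ = 0
  equilibrium : ∃ f : EdgeLp ι p, IsEquilibriumFunction P p E f ∧
    ∀ i, f i = edgeFunction P p μ i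
  mass : μ Set.univ = capacity P p E

/-! ### The rescaled measure on a tent -/

/-- `IM_p(b(α))`, the potential of `M_p` at the beginning vertex of `α`. -/
def potentialAtBeginning (p : ℝ) (μ : Measure (Boundary G o)) (α : Edge G o) : ℝ≥0∞ :=
  potential (vertexPred G o α.b) (edgeFunction Boundary.pred p μ)

/-- The constant `k_α = (1 - IM_p(b(α)))^{-p/p'}`. -/
def rescalingConstant (p : ℝ) (μ : Measure (Boundary G o)) (α : Edge G o) : ℝ≥0∞ :=
  ((1 - potentialAtBeginning p μ α) ^ (p / p.conjExponent))⁻¹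

/-- The measure `μ|_{∂T_α} / (1 - IM_p(b(α)))^{p/p'}`, as a measure on `∂T_α`. -/
def rescaledMeasure (p : ℝ) (μ : Measure (Boundary G o)) (α : Edge G o) :
    Measure (tentBoundary α) :=
  rescalingConstant p μ α • μ.comap ((↑) : tentBoundary α → Boundary G o)

end

end TreeCapacity

/-! Let `f = M_p` be the equilibrium function and `gap = 1 - If(b(α))`. Everything in (1) comes from
one competitor: replace `f` on the tent by `max 0 gap • h`, with `h` a test function of the tent.
The result stays in the closure of `Ω_E` and agrees with `f` off the tent, so minimality gives
`‖f|T_α‖ ≤ max 0 gap * ‖h‖` (`enorm_lpRestrict_le`).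

With `h` the unit mass at `α` this yields `f(α) ≤ max 0 gap`, hence `If ≤ 1` everywhere; with `h`
arbitrary it shows that `gap⁻¹ f|T_α` is the equilibrium function of the tent. As `∫ If dμ = ‖f‖^p =
c_p(E) = μ(∂T)`, also `If = 1` almost everywhere, which gives the mass of the rescaled measure.
Strictness `If(b(α)) < 1`: past a vertex where `If` first reaches `1` there is no room for `f`, so
no mass, and the edge reaching that vertex would carry none either
(`potential_vertexPred_b_lt_one`).

For (2), spend a small amount `a` on an edge before the tent and scale the test functions of the
tent by `1 - a`: the cost `a^p` is of higher order than the gain. -/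

namespace TreeCapacity

/-! ### Geodesics and tents in a rooted tree -/

section Tree

variable {V : Type*} {G : SimpleGraph V} {o : V}

theorem IsRootedTree.exists_edge_e_eq (hT : IsRootedTree G o) {x : V} (hx : x ≠ o) :
    ∃ β : Edge G o, β.e = x := by
  obtain ⟨w, hw⟩ := hT.isTree.connected.exists_walk_length_eq_dist x o
  cases w with
  | nil => exact absurd rfl hx
  | cons h q =>
    rename_i y
    refine ⟨⟨y, x, h.symm, ?_⟩, rfl⟩
    have h1 := SimpleGraph.dist_le q
    have h2 := hT.isTree.dist_eq_dist_add_one_of_adj o h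
    rw [SimpleGraph.Walk.length_cons, SimpleGraph.dist_comm] at hw
    rw [SimpleGraph.dist_comm] at h1
    omega

theorem IsRootedTree.vertex_induction (hT : IsRootedTree G o) {motive : V → Prop}
    (root : motive o) (step : ∀ β : Edge G o, motive β.b → motive β.e) (x : V) : motive x := by
  induction hn : G.dist o x using Nat.strong_induction_on generalizing x with
  | _ n ih =>
    by_cases hx : x = o
    · exact hx ▸ root
    · obtain ⟨β, rfl⟩ := hT.exists_edge_e_eq hx
      exact step β (ih _ (by rw [← hn, β.outward]; omega) _ rfl)

theorem Edge.ext_of_mk_eq {α β : Edge G o} (h : s(α.b, α.e) = s(β.b, β.e)) : α = β := by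
  rcases Sym2.eq_iff.1 h with h | h
  · exact Edge.ext h.1 h.2
  · have h1 := α.outward
    have h2 := β.outward
    rw [h.1, h.2] at h1
    omega

theorem vertexPred_root : vertexPred G o o = ∅ := by
  refine Set.eq_empty_of_forall_notMem ?_
  rintro α ⟨w, hw, hα⟩
  have hw := SimpleGraph.Walk.isPath_iff_nil.1 hw
  cases w with
  | nil => simp at hα
  | cons h q => simp at hw

/-- Paths in a tree are unique, and the geodesic to `β.b` followed by `β` is one. With
`vertex_induction`, this recursion replaces walks in all that follows. -/
theorem IsRootedTree.vertexPred_e (hT : IsRootedTree G o) (β : Edge G o) :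
    vertexPred G o β.e = insert β (vertexPred G o β.b) := by
  obtain ⟨w, hw⟩ := hT.isTree.connected.exists_walk_length_eq_dist o β.b
  have hwp := w.isPath_of_length_eq_dist hw
  have hcp : (w.concat β.adj).IsPath :=
    (w.concat β.adj).isPath_of_length_eq_dist (by simp [hw, β.outward])
  have hu : ∀ {x : V} {q q' : G.Walk o x}, q.IsPath → q'.IsPath → q = q' := fun hq hq' =>
    (hT.isTree.existsUnique_path _ _).unique hq hq'
  ext α
  constructor
  · rintro ⟨q, hq, hα⟩
    rw [hu hq hcp, SimpleGraph.Walk.edges_concat] at hα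
    simp only [List.concat_eq_append, List.mem_append, List.mem_singleton] at hα
    rcases hα with hα | hα
    · exact Or.inr ⟨w, hwp, hα⟩
    · exact Or.inl (Edge.ext_of_mk_eq hα)
  · rintro (rfl | ⟨q, hq, hα⟩)
    · exact ⟨_, hcp, by simp [SimpleGraph.Walk.edges_concat]⟩
    · refine ⟨_, hcp, ?_⟩
      rw [hu hq hwp] at hα
      simp [SimpleGraph.Walk.edges_concat, hα]

theorem IsRootedTree.le_refl (hT : IsRootedTree G o) (α : Edge G o) : α ≤ α := by
  change α ∈ vertexPred G o α.e
  rw [hT.vertexPred_e]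
  exact Set.mem_insert _ _

theorem IsRootedTree.dist_e_le (hT : IsRootedTree G o) {α : Edge G o} {x : V} :
    α ∈ vertexPred G o x → G.dist o α.e ≤ G.dist o x := by
  induction x using hT.vertex_induction with
  | root => simp [vertexPred_root]
  | step β ih =>
    rw [hT.vertexPred_e]
    rintro (rfl | h)
    · exact _root_.le_refl _
    · exact (ih h).trans (by rw [β.outward]; omega)

theorem IsRootedTree.notMem_vertexPred_b (hT : IsRootedTree G o) {α β : Edge G o} (h : α ≤ β) :
    β ∉ vertexPred G o α.b := fun h' => by
  have h1 := hT.dist_e_le h'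
  have h2 := hT.dist_e_le (show α ∈ vertexPred G o β.e from h)
  have h3 := α.outward
  omega

theorem IsRootedTree.e_injective (hT : IsRootedTree G o) :
    Function.Injective (Edge.e : Edge G o → V) := by
  intro β γ h
  have h1 : γ ∈ vertexPred G o β.e := h ▸ hT.le_refl γ
  rw [hT.vertexPred_e] at h1
  rcases h1 with h1 | h1
  · exact h1.symm
  · have h2 := hT.dist_e_le h1
    have h3 := β.outward
    rw [h] at h3
    omega

theorem IsRootedTree.vertexPred_subset (hT : IsRootedTree G o) {α : Edge G o} {x : V} :
    α ∈ vertexPred G o x → vertexPred G o α.e ⊆ vertexPred G o x := by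
  induction x using hT.vertex_induction with
  | root => simp [vertexPred_root]
  | step β ih =>
    rw [hT.vertexPred_e β]
    rintro (rfl | h)
    · rw [hT.vertexPred_e]
    · exact (ih h).trans (Set.subset_insert _ _)

theorem IsRootedTree.vertexPred_total (hT : IsRootedTree G o) {α β : Edge G o} {x : V} :
    α ∈ vertexPred G o x → β ∈ vertexPred G o x → α ≤ β ∨ β ≤ α := by
  induction x using hT.vertex_induction with
  | root => simp [vertexPred_root]
  | step γ ih =>
    intro hα hβ
    have hα' := hα
    have hβ' := hβ
    rw [hT.vertexPred_e] at hα' hβ'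
    rcases hα' with rfl | hα'
    · exact Or.inr hβ
    · rcases hβ' with rfl | hβ'
      · exact Or.inl hα
      · exact ih hα' hβ'

theorem IsRootedTree.vertexPred_finite (hT : IsRootedTree G o) (x : V) :
    (vertexPred G o x).Finite := by
  induction x using hT.vertex_induction with
  | root => simp [vertexPred_root]
  | step β ih => rw [hT.vertexPred_e]; exact ih.insert β

theorem IsRootedTree.exists_next_mem_vertexPred (hT : IsRootedTree G o) {β : Edge G o} {x : V} :
    β ∈ vertexPred G o x → β.e = x ∨ ∃ γ ∈ vertexPred G o x, γ.b = β.e := by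
  induction x using hT.vertex_induction with
  | root => simp [vertexPred_root]
  | step δ ih =>
    rw [hT.vertexPred_e]
    rintro (rfl | h)
    · exact Or.inl rfl
    · rcases ih h with h' | ⟨γ, hγ, hb⟩
      · exact Or.inr ⟨δ, Set.mem_insert _ _, h'.symm⟩
      · exact Or.inr ⟨γ, Set.mem_insert_of_mem _ hγ, hb⟩

/-- A first step back towards the root would retrace the edge just crossed, since an edge is
determined by its ending vertex; this contradicts injectivity. -/
theorem IsRootedTree.ray_outward (hT : IsRootedTree G o) {r : ℕ → V} (start : r 0 = o)
    (adj : ∀ n, G.Adj (r n) (r (n + 1))) (inj : Function.Injective r) (n : ℕ) :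
    G.dist o (r (n + 1)) = G.dist o (r n) + 1 := by
  induction n with
  | zero =>
    have := hT.isTree.dist_eq_dist_add_one_of_adj o (adj 0)
    rw [start, SimpleGraph.dist_self] at *
    omega
  | succ n ih =>
    rcases hT.isTree.dist_eq_dist_add_one_of_adj o (adj (n + 1)) with h | h
    · have := hT.e_injective (a₁ := ⟨_, _, adj n, ih⟩) (a₂ := ⟨_, _, (adj (n + 1)).symm, h⟩) rfl
      have := inj (congrArg Edge.b this)
      omega
    · exact h

theorem IsRootedTree.ray_vertexPred (hT : IsRootedTree G o) {r : ℕ → V} (start : r 0 = o)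
    (adj : ∀ n, G.Adj (r n) (r (n + 1))) (inj : Function.Injective r) (n : ℕ) :
    vertexPred G o (r n) = {α | ∃ k < n, α.b = r k ∧ α.e = r (k + 1)} := by
  induction n with
  | zero => simp [start, vertexPred_root]
  | succ n ih =>
    have h := hT.vertexPred_e (⟨_, _, adj n, hT.ray_outward start adj inj n⟩ : Edge G o)
    simp only at h
    rw [h, ih]
    ext α
    simp only [Set.mem_insert_iff, Set.mem_ofPred_eq, Edge.ext_iff]
    constructor
    · rintro (h | ⟨k, hk, h⟩)
      · exact ⟨n, by omega, h⟩
      · exact ⟨k, by omega, h⟩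
    · rintro ⟨k, hk, hα⟩
      rcases Nat.lt_succ_iff_lt_or_eq.1 hk with hk | rfl
      · exact Or.inr ⟨k, hk, hα⟩
      · exact Or.inl hα

/-- Any two predecessors of a boundary point are predecessors of a vertex all of whose
predecessors are predecessors of the boundary point. -/
theorem IsRootedTree.exists_vertex_of_mem_pred (hT : IsRootedTree G o) {ζ : Boundary G o}
    {α β : Edge G o} (hα : α ∈ ζ.pred) (hβ : β ∈ ζ.pred) :
    ∃ x, α ∈ vertexPred G o x ∧ β ∈ vertexPred G o x ∧ vertexPred G o x ⊆ ζ.pred := by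
  cases ζ with
  | leaf δ hδ => exact ⟨δ.e, hα, hβ, subset_rfl⟩
  | ray r start adj inj =>
    obtain ⟨n, hn⟩ := hα
    obtain ⟨m, hm⟩ := hβ
    refine ⟨r (max n m + 1), ?_, ?_, ?_⟩ <;> rw [hT.ray_vertexPred start adj inj]
    · exact ⟨n, by omega, hn⟩
    · exact ⟨m, by omega, hm⟩
    · rintro γ ⟨k, -, hk⟩
      exact ⟨k, hk⟩

theorem IsRootedTree.vertexPred_subset_pred (hT : IsRootedTree G o) {ζ : Boundary G o}
    {α : Edge G o} (hα : α ∈ ζ.pred) : vertexPred G o α.e ⊆ ζ.pred := by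
  obtain ⟨x, hx, -, h⟩ := hT.exists_vertex_of_mem_pred hα hα
  exact (hT.vertexPred_subset hx).trans h

theorem IsRootedTree.pred_total (hT : IsRootedTree G o) {ζ : Boundary G o}
    {α β : Edge G o} (hα : α ∈ ζ.pred) (hβ : β ∈ ζ.pred) : α ≤ β ∨ β ≤ α := by
  obtain ⟨x, h1, h2, -⟩ := hT.exists_vertex_of_mem_pred hα hβ
  exact hT.vertexPred_total h1 h2

/-- The geodesic to a point of `∂T_α` splits into the part before `α` and the part in the tent. -/
theorem IsRootedTree.pred_eq_union (hT : IsRootedTree G o) (α : Edge G o)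
    (ζ : tentBoundary α) :
    ζ.1.pred = vertexPred G o α.b ∪ Subtype.val '' tentPred α ζ := by
  have hζ : vertexPred G o α.e ⊆ ζ.1.pred := hT.vertexPred_subset_pred ζ.2
  ext β
  constructor
  · intro hβ
    rcases hT.pred_total ζ.2 hβ with h | h
    · exact Or.inr ⟨⟨β, h⟩, hβ, rfl⟩
    · have h' : β ∈ vertexPred G o α.e := h
      rw [hT.vertexPred_e] at h'
      rcases h' with rfl | h'
      · exact Or.inr ⟨⟨β, h⟩, hβ, rfl⟩
      · exact Or.inl h'
  · rintro (h | ⟨γ, hγ, rfl⟩)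
    · exact hζ (by rw [hT.vertexPred_e]; exact Or.inr h)
    · exact hγ

/-- The edge `α` beginning where `β` ends shows that `β` is not a leaf, so no geodesic through `β`
can stop there. -/
theorem IsRootedTree.exists_next_mem_pred (hT : IsRootedTree G o) {ζ : Boundary G o}
    {α β : Edge G o} (hα : α.b = β.e) (hβ : β ∈ ζ.pred) : ∃ γ ∈ ζ.pred, γ.b = β.e := by
  cases ζ with
  | leaf δ hδ =>
    rcases hT.exists_next_mem_vertexPred (show β ∈ vertexPred G o δ.e from hβ) with h | h
    · have h1 := hT.e_injective h
      subst h1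
      have h2 : α = β := hδ α (by
        change β ∈ vertexPred G o α.e
        rw [hT.vertexPred_e, hα]
        exact Or.inr (hT.le_refl β))
      subst h2
      exact absurd hα α.adj.ne
    · exact h
  | ray r start adj inj =>
    obtain ⟨n, -, hn⟩ := hβ
    exact ⟨⟨_, _, adj (n + 1), hT.ray_outward start adj inj (n + 1)⟩, ⟨n + 1, rfl, rfl⟩, hn.symm⟩

/-- By local finiteness the spheres about the root are finite. Countability is what allows sums over
edges to be exchanged with integrals. -/
theorem IsRootedTree.countable_edge (hT : IsRootedTree G o) : Countable (Edge G o) := by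
  have hfin : ∀ n, {x : V | G.dist o x = n}.Finite := by
    intro n
    induction n with
    | zero =>
      refine (Set.finite_singleton o).subset fun x hx => ?_
      exact (hT.isTree.connected.dist_eq_zero_iff.1 hx).symm
    | succ n ih =>
      refine (ih.biUnion fun x _ => hT.locallyFinite x).subset fun x hx => ?_
      have hxo : x ≠ o := by
        rintro rfl
        simp at hx
      obtain ⟨β, rfl⟩ := hT.exists_edge_e_eq hxo
      have h1 := β.outward
      have h2 : G.dist o β.e = n + 1 := hx
      exact Set.mem_biUnion (show β.b ∈ {x : V | G.dist o x = n} by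
        simp only [Set.mem_ofPred_eq]; omega) β.adj
  have hV : Countable V := by
    refine Set.countable_univ_iff.1 ?_
    have : (Set.univ : Set V) = ⋃ n, {x : V | G.dist o x = n} := by
      ext x; simp
    rw [this]
    exact Set.countable_iUnion fun n => (hfin n).countable
  exact hT.e_injective.countable

theorem isOpen_tentBoundary (α : Edge G o) : IsOpen (tentBoundary α) :=
  TopologicalSpace.isOpen_generateFrom_of_mem ⟨α, rfl⟩

theorem measurableSet_tentBoundary (α : Edge G o) : MeasurableSet (tentBoundary α) :=
  (isOpen_tentBoundary α).measurableSet

theorem IsRootedTree.tentBoundary_subset (hT : IsRootedTree G o) {α β : Edge G o} (h : α ≤ β) :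
    tentBoundary β ⊆ tentBoundary α := fun _ hζ => hT.vertexPred_subset_pred hζ h

end Tree

end TreeCapacity

namespace TreeCapacity

noncomputable section

/-! ### Restriction, extension and gluing in `ℓ^p` -/

section EdgeLp

variable {ι : Type*} {p : ℝ} [hp : Fact (1 < p)]

theorem toReal_ofReal_exponent : (ENNReal.ofReal p).toReal = p :=
  ENNReal.toReal_ofReal (zero_lt_one.trans hp.out).le

theorem ofReal_exponent_ne_zero : ENNReal.ofReal p ≠ 0 := by
  simpa using zero_lt_one.trans hp.out

theorem summable_norm_rpow (f : EdgeLp ι p) : Summable fun i => ‖f i‖ ^ p := by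
  have h := (lp.memℓp f).summable (by rw [toReal_ofReal_exponent]; linarith [hp.out])
  rwa [toReal_ofReal_exponent] at h

theorem memℓp_of_summable {f : ι → ℝ} (h : Summable fun i => ‖f i‖ ^ p) :
    Memℓp f (ENNReal.ofReal p) :=
  memℓp_gen (by rwa [toReal_ofReal_exponent])

theorem norm_rpow_eq (f : EdgeLp ι p) : ‖f‖ ^ p = ∑' i, ‖f i‖ ^ p := by
  have h := lp.norm_rpow_eq_tsum (p := ENNReal.ofReal p)
    (by rw [toReal_ofReal_exponent]; linarith [hp.out]) f
  rwa [toReal_ofReal_exponent] at h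

theorem enorm_rpow_eq_ofReal {E : Type*} [NormedAddCommGroup E] (x : E) :
    ‖x‖ₑ ^ p = ENNReal.ofReal (‖x‖ ^ p) := by
  rw [← ofReal_norm, ENNReal.ofReal_rpow_of_nonneg (norm_nonneg _) (by linarith [hp.out])]

theorem enorm_rpow_eq_tsum (f : EdgeLp ι p) : ‖f‖ₑ ^ p = ∑' i, ‖f i‖ₑ ^ p := by
  simp_rw [enorm_rpow_eq_ofReal, norm_rpow_eq]
  exact ENNReal.ofReal_tsum_of_nonneg (fun i => by positivity) (summable_norm_rpow f)

theorem enorm_le_of_rpow_le {a b : ℝ≥0∞} (h : a ^ p ≤ b ^ p) : a ≤ b :=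
  (ENNReal.rpow_le_rpow_iff (zero_lt_one.trans hp.out)).1 h

variable (q : ι → Prop)

/-- Restriction of an `ℓ^p` function to the indices satisfying `q`. -/
def lpRestrict : EdgeLp ι p →L[ℝ] EdgeLp {i // q i} p :=
  LinearMap.mkContinuous
    { toFun f := ⟨fun i => f i.1, memℓp_of_summable
        ((summable_norm_rpow f).comp_injective Subtype.val_injective)⟩
      map_add' _ _ := rfl
      map_smul' _ _ := rfl } 1 fun f => by
    rw [one_mul, ← enorm_le_iff_norm_le]
    refine enorm_le_of_rpow_le (p := p) ?_
    simp_rw [enorm_rpow_eq_tsum]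
    exact ENNReal.tsum_comp_le_tsum_of_injective Subtype.val_injective fun i => ‖f i‖ₑ ^ p

@[simp]
theorem lpRestrict_apply (f : EdgeLp ι p) (i : {i // q i}) : lpRestrict q f i = f i.1 := rfl

open Classical in
/-- Extension of an `ℓ^p` function by zero. -/
def lpExtend : EdgeLp {i // q i} p →L[ℝ] EdgeLp ι p :=
  LinearMap.mkContinuous
    { toFun h := ⟨fun i => if hi : q i then h ⟨i, hi⟩ else 0, memℓp_of_summable (by
        have hs := summable_norm_rpow h
        refine (Function.Injective.summable_iff (f := fun i : ι =>
          ‖if hi : q i then h ⟨i, hi⟩ else 0‖ ^ p) (Subtype.val_injective (p := q)) ?_).1 ?_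
        · intro i hi
          have hi : ¬ q i := by simpa using hi
          simp [hi, Real.zero_rpow (zero_lt_one.trans hp.out).ne']
        · refine hs.congr fun i => ?_
          simp [i.2])⟩
      map_add' f g := by
        ext i
        change (if hi : q i then f ⟨i, hi⟩ + g ⟨i, hi⟩ else 0) =
          (if hi : q i then f ⟨i, hi⟩ else 0) + (if hi : q i then g ⟨i, hi⟩ else 0)
        by_cases hi : q i <;> simp [hi]
      map_smul' c f := by
        ext i
        by_cases hi : q i <;> simp [hi] } 1 fun f => by
    rw [one_mul, ← enorm_le_iff_norm_le]
    refine enorm_le_of_rpow_le (p := p) ?_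
    simp_rw [enorm_rpow_eq_tsum]
    refine le_of_eq ?_
    refine (tsum_eq_tsum_of_ne_zero_bij (fun i => i.1.1) ?_ ?_ ?_).trans rfl
    · intro i j hij
      exact Subtype.ext (Subtype.ext hij)
    · intro i hi
      by_cases hq : q i
      · exact ⟨⟨⟨i, hq⟩, by simpa [hq] using hi⟩, rfl⟩
      · simp [hq, ENNReal.zero_rpow_of_pos (zero_lt_one.trans hp.out)] at hi
    · intro i
      simp [i.1.2]

theorem lpExtend_apply_of_mem (h : EdgeLp {i // q i} p) {i : ι} (hi : q i) :
    lpExtend q h i = h ⟨i, hi⟩ := dif_pos hi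

theorem lpExtend_apply_of_not (h : EdgeLp {i // q i} p) {i : ι} (hi : ¬ q i) :
    lpExtend q h i = 0 := dif_neg hi

/-- The function which is `h` on the indices satisfying `q` and `f` on the others. -/
def lpGlue (f : EdgeLp ι p) (h : EdgeLp {i // q i} p) : EdgeLp ι p :=
  f + lpExtend q (h - lpRestrict q f)

theorem lpGlue_apply_of_mem (f : EdgeLp ι p) (h : EdgeLp {i // q i} p) {i : ι} (hi : q i) :
    lpGlue q f h i = h ⟨i, hi⟩ := by
  simp [lpGlue, lpExtend_apply_of_mem q _ hi]

theorem lpGlue_apply_of_not (f : EdgeLp ι p) (h : EdgeLp {i // q i} p) {i : ι} (hi : ¬ q i) :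
    lpGlue q f h i = f i := by
  simp [lpGlue, lpExtend_apply_of_not q _ hi]

/-- Immediate because gluing is built from the continuous linear restriction and extension; needed
to pass to closures. -/
theorem continuous_lpGlue :
    Continuous fun x : EdgeLp ι p × EdgeLp {i // q i} p => lpGlue q x.1 x.2 := by
  unfold lpGlue
  fun_prop

theorem enorm_lpGlue_rpow (f : EdgeLp ι p) (h : EdgeLp {i // q i} p) :
    ‖lpGlue q f h‖ₑ ^ p = ‖h‖ₑ ^ p + ∑' i : {i // ¬ q i}, ‖f i.1‖ₑ ^ p := by
  rw [enorm_rpow_eq_tsum, enorm_rpow_eq_tsum,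
    ← ENNReal.summable.tsum_add_tsum_compl (s := {i | q i}) ENNReal.summable]
  congr 1
  · exact tsum_congr fun i => by rw [lpGlue_apply_of_mem q f h i.2]; rfl
  · exact tsum_congr fun i => by rw [lpGlue_apply_of_not q f h i.2]

theorem enorm_rpow_split (f : EdgeLp ι p) :
    ‖f‖ₑ ^ p = ‖lpRestrict q f‖ₑ ^ p + ∑' i : {i // ¬ q i}, ‖f i.1‖ₑ ^ p := by
  rw [← enorm_lpGlue_rpow]
  congr 2
  simp [lpGlue]

theorem continuous_lp_apply (i : ι) : Continuous fun f : EdgeLp ι p => f i :=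
  (lp.lipschitzWith_one_eval (E := fun _ : ι => ℝ) (ENNReal.ofReal p) i).continuous

theorem norm_apply_le (f : EdgeLp ι p) (i : ι) : ‖f i‖ ≤ ‖f‖ :=
  lp.norm_apply_le_norm ofReal_exponent_ne_zero f i

end EdgeLp

/-! ### Potentials, capacity and energy -/

section Potential

variable {ι X : Type*} {P : X → Set ι} {p : ℝ} {E : Set X}

theorem potential_congr {S : Set ι} {f g : ι → ℝ} (h : ∀ i ∈ S, f i = g i) :
    potential S f = potential S g :=
  tsum_congr fun i => by rw [h i i.2]

theorem potential_const_mul {S : Set ι} {f : ι → ℝ} {c : ℝ} (hc : 0 ≤ c) :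
    potential S (fun i => c * f i) = ENNReal.ofReal c * potential S f := by
  simp_rw [potential, ENNReal.ofReal_mul hc, ENNReal.tsum_mul_left]

theorem ofReal_le_potential {S : Set ι} {f : ι → ℝ} {i : ι} (hi : i ∈ S) :
    ENNReal.ofReal (f i) ≤ potential S f :=
  ENNReal.le_tsum (f := fun i : S => ENNReal.ofReal (f i)) ⟨i, hi⟩

theorem potential_eq_ofReal_sum {S : Set ι} (hS : S.Finite) {f : ι → ℝ} (hf : ∀ i, 0 ≤ f i) :
    potential S f = ENNReal.ofReal (∑ i ∈ hS.toFinset, f i) := by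
  have h := Finset.tsum_subtype hS.toFinset fun i => ENNReal.ofReal (f i)
  rw [ENNReal.ofReal_sum_of_nonneg fun i _ => hf i, ← h]
  have hS' : S = {i | i ∈ hS.toFinset} := by ext; simp
  unfold potential
  conv_lhs => rw [hS']
  rfl

theorem nonneg_of_mem_closure [hp : Fact (1 < p)] {f : EdgeLp ι p}
    (hf : f ∈ closure (testFunctions P p E)) (i : ι) : 0 ≤ f i := by
  have hc : IsClosed {f : EdgeLp ι p | 0 ≤ f i} :=
    isClosed_le continuous_const (continuous_lp_apply i)
  exact closure_minimal (fun g hg => hg.1 i) hc hf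

theorem capacity_le_of_mem_closure [hp : Fact (1 < p)] {f : EdgeLp ι p}
    (hf : f ∈ closure (testFunctions P p E)) : capacity P p E ≤ ‖f‖ₑ ^ p := by
  have hc : IsClosed {f : EdgeLp ι p | capacity P p E ≤ ‖f‖ₑ ^ p} :=
    isClosed_le continuous_const (ENNReal.continuous_rpow_const.comp continuous_enorm)
  have hs : testFunctions P p E ⊆ {f : EdgeLp ι p | capacity P p E ≤ ‖f‖ₑ ^ p} :=
    fun g hg => iInf₂_le (f := fun g (_ : g ∈ testFunctions P p E) => ‖g‖ₑ ^ p) g hg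
  exact closure_minimal hs hc hf

/-- The energy of a measure is the integral of its potential. -/
theorem enorm_rpow_eq_lintegral_potential [hp : Fact (1 < p)] [Countable ι] [MeasurableSpace X]
    (hP : ∀ i, MeasurableSet {x | i ∈ P x}) (μ : Measure X) [IsFiniteMeasure μ]
    {f : EdgeLp ι p} (hf : ∀ i, f i = edgeFunction P p μ i) :
    ‖f‖ₑ ^ p = ∫⁻ x, potential (P x) f ∂μ := by
  have h1 : ∀ x, potential (P x) f =
      ∑' i, {x | i ∈ P x}.indicator (fun _ => ENNReal.ofReal (f i)) x := fun x => by
    rw [potential, tsum_subtype (P x) fun i => ENNReal.ofReal (f i)]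
    exact tsum_congr fun i => by by_cases hi : i ∈ P x <;> simp [hi]
  simp_rw [h1]
  rw [lintegral_tsum fun i => (measurable_const.indicator (hP i)).aemeasurable, enorm_rpow_eq_tsum]
  refine tsum_congr fun i => ?_
  rw [lintegral_indicator_const (hP i), enorm_rpow_eq_ofReal, hf, edgeFunction,
    ← ofReal_measureReal, ← ENNReal.ofReal_mul (by unfold copotential; positivity)]
  congr 1
  have hM : 0 ≤ copotential P μ i := measureReal_nonneg
  have h0 : 0 < p - 1 := by linarith [hp.out]
  change _ = copotential P μ i ^ (p.conjExponent - 1) * copotential P μ i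
  rw [Real.norm_of_nonneg (by positivity), ← Real.rpow_mul hM]
  -- The integrand identity is `M^((p'-1)p) = M^(p'-1) * M`: the exponents agree because
  -- `(p'-1)(p-1) = 1`.
  have he : p.conjExponent - 1 = 1 / (p - 1) := by
    rw [Real.conjExponent]; field_simp; ring
  rw [he]
  conv_rhs => rw [← Real.rpow_add_one' hM (by positivity)]
  congr 1
  field_simp
  ring

end Potential

end

end TreeCapacity

namespace TreeCapacity

noncomputable section

/-! ### Competitors glued along a tent, and the bound `If ≤ 1` -/

section Gluing

variable {V : Type*} {G : SimpleGraph V} {o : V} {p : ℝ} {E : Set (Boundary G o)}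

theorem IsRootedTree.potential_pred_eq (hT : IsRootedTree G o) (α : Edge G o)
    (ζ : tentBoundary α) (f : Edge G o → ℝ) :
    potential ζ.1.pred f =
      potential (vertexPred G o α.b) f + potential (tentPred α ζ) fun β => f β.1 := by
  have hd : Disjoint (vertexPred G o α.b) (Subtype.val '' tentPred α ζ) := by
    rw [Set.disjoint_left]
    rintro _ hγ ⟨γ, -, rfl⟩
    exact hT.notMem_vertexPred_b γ.2 hγ
  unfold potential
  rw [hT.pred_eq_union α ζ, ENNReal.summable.tsum_union_disjoint
    (f := fun i => ENNReal.ofReal (f i)) hd ENNReal.summable]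
  congr 1
  exact tsum_image (fun i => ENNReal.ofReal (f i)) Subtype.val_injective.injOn

theorem IsRootedTree.potential_vertexPred_e (hT : IsRootedTree G o) (β : Edge G o)
    (f : Edge G o → ℝ) :
    potential (vertexPred G o β.e) f =
      ENNReal.ofReal (f β) + potential (vertexPred G o β.b) f := by
  have hd : Disjoint {β} (vertexPred G o β.b) :=
    Set.disjoint_singleton_left.2 (hT.notMem_vertexPred_b (hT.le_refl β))
  unfold potential
  rw [hT.vertexPred_e, Set.insert_eq, ENNReal.summable.tsum_union_disjoint
    (f := fun i => ENNReal.ofReal (f i)) hd ENNReal.summable,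
    tsum_singleton β fun i => ENNReal.ofReal (f i)]

/-- The difference `1 - If(b(α))`. -/
def IsRootedTree.gap (hT : IsRootedTree G o) (α : Edge G o) (f : Edge G o → ℝ) : ℝ :=
  1 - ∑ i ∈ (hT.vertexPred_finite α.b).toFinset, f i

/-- The gap may be negative, but `1 - gap` is a sum of nonnegative terms, so `ENNReal.ofReal`
truncates nothing. -/
theorem IsRootedTree.potential_eq_gap (hT : IsRootedTree G o) (α : Edge G o)
    {f : Edge G o → ℝ} (hf : ∀ i, 0 ≤ f i) :
    potential (vertexPred G o α.b) f = ENNReal.ofReal (1 - hT.gap α f) := by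
  rw [potential_eq_ofReal_sum (hT.vertexPred_finite α.b) hf, gap, sub_sub_cancel]

theorem IsRootedTree.gap_le_one (hT : IsRootedTree G o) (α : Edge G o)
    {f : Edge G o → ℝ} (hf : ∀ i, 0 ≤ f i) : hT.gap α f ≤ 1 :=
  sub_le_self _ (Finset.sum_nonneg fun i _ => hf i)

theorem single_mem_testFunctions (α : Edge G o) [DecidableEq (TentEdge α)] (h : α ≤ α)
    (F : Set (tentBoundary α)) :
    (lp.single (ENNReal.ofReal p) (⟨α, h⟩ : TentEdge α) (1 : ℝ) : EdgeLp (TentEdge α) p) ∈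
      testFunctions (tentPred α) p F := by
  refine ⟨fun i => ?_, fun ζ _ => ?_⟩
  · rw [lp.single_apply, Pi.single_apply]
    split_ifs <;> norm_num
  · refine le_trans ?_ (ofReal_le_potential (show (⟨α, h⟩ : TentEdge α) ∈ tentPred α ζ from ζ.2))
    simp

variable [hp : Fact (1 < p)]

theorem IsRootedTree.continuous_gap (hT : IsRootedTree G o) (α : Edge G o) :
    Continuous fun f : EdgeLp (Edge G o) p => hT.gap α f :=
  continuous_const.sub (continuous_finsetSum _ fun i _ => continuous_lp_apply i)

/-- On a geodesic into the tent, the part before `α` still sees `f` and the part inside contributes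
at least `s`. A geodesic avoiding `α` meets no edge of the tent. -/
theorem IsRootedTree.lpGlue_mem_testFunctions (hT : IsRootedTree G o) (α : Edge G o)
    {f : EdgeLp (Edge G o) p} (hf : ∀ i, 0 ≤ f i)
    (hfE : ∀ ζ ∈ E, ζ ∉ tentBoundary α → 1 ≤ potential ζ.pred f)
    {h : EdgeLp (TentEdge α) p}
    (hh : h ∈ testFunctions (tentPred α) p ((↑) ⁻¹' E : Set (tentBoundary α)))
    {s : ℝ} (hs : 0 ≤ s) (h1 : 1 ≤ potential (vertexPred G o α.b) f + ENNReal.ofReal s) :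
    lpGlue (α ≤ ·) f (s • h) ∈ testFunctions Boundary.pred p E := by
  have hmem : ∀ β : TentEdge α, lpGlue (α ≤ ·) f (s • h) β.1 = s * h β := fun β =>
    lpGlue_apply_of_mem (α ≤ ·) f (s • h) β.2
  refine ⟨fun i => ?_, fun ζ hζ => ?_⟩
  · by_cases hi : α ≤ i
    · rw [hmem ⟨i, hi⟩]
      exact mul_nonneg hs (hh.1 _)
    · rw [lpGlue_apply_of_not _ _ _ hi]
      exact hf i
  · by_cases hζα : ζ ∈ tentBoundary α
    · rw [hT.potential_pred_eq α ⟨ζ, hζα⟩]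
      simp_rw [hmem]
      rw [potential_const_mul hs, potential_congr (g := f)]
      · refine h1.trans (add_le_add_right ?_ _)
        exact le_mul_of_one_le_right' (hh.2 ⟨ζ, hζα⟩ hζ)
      · intro i hi
        exact lpGlue_apply_of_not _ _ _ fun hi' => hT.notMem_vertexPred_b hi' hi
    · rw [potential_congr (g := f)]
      · exact hfE ζ hζ hζα
      · intro i hi
        exact lpGlue_apply_of_not _ _ _ fun hi' => hζα (hT.tentBoundary_subset hi' hi)

/-- The limit `f` need not satisfy `If ≥ 1` on `E`, so gluing is done for test functions near `f`.
The factor `max 0 gap` is nonnegative and continuous in the function, hence the result passes to the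
limit. -/
theorem IsRootedTree.lpGlue_mem_closure (hT : IsRootedTree G o) (α : Edge G o)
    {f : EdgeLp (Edge G o) p} (hf : f ∈ closure (testFunctions Boundary.pred p E))
    {h : EdgeLp (TentEdge α) p}
    (hh : h ∈ testFunctions (tentPred α) p ((↑) ⁻¹' E : Set (tentBoundary α))) :
    lpGlue (α ≤ ·) f (max 0 (hT.gap α f) • h) ∈ closure (testFunctions Boundary.pred p E) := by
  have hc : Continuous fun f : EdgeLp (Edge G o) p =>
      lpGlue (α ≤ ·) f (max 0 (hT.gap α f) • h) :=
    (continuous_lpGlue (p := p) (α ≤ · : Edge G o → Prop)).comp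
      (continuous_id.prodMk
        ((continuous_const.max (hT.continuous_gap α)).smul continuous_const))
  refine map_mem_closure (f := fun f : EdgeLp (Edge G o) p =>
    lpGlue (α ≤ ·) f (max 0 (hT.gap α f) • h)) hc hf fun g hg =>
    hT.lpGlue_mem_testFunctions α hg.1 (fun ζ hζ _ => hg.2 ζ hζ) hh (le_max_left _ _) ?_
  rw [hT.potential_eq_gap α hg.1, ← ENNReal.ofReal_add
    (sub_nonneg.2 (hT.gap_le_one α hg.1)) (le_max_left _ _), ENNReal.one_le_ofReal]
  linarith [le_max_right 0 (hT.gap α g)]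

/-- Compare `f` with the glued competitor: the contributions from outside the tent are equal and
finite, so they cancel. -/
theorem IsRootedTree.enorm_lpRestrict_le (hT : IsRootedTree G o) (α : Edge G o)
    {f : EdgeLp (Edge G o) p} (hf : IsEquilibriumFunction Boundary.pred p E f)
    {h : EdgeLp (TentEdge α) p}
    (hh : h ∈ testFunctions (tentPred α) p ((↑) ⁻¹' E : Set (tentBoundary α))) :
    ‖lpRestrict (α ≤ ·) f‖ₑ ≤ ‖max 0 (hT.gap α f) • h‖ₑ := by
  refine enorm_le_of_rpow_le (p := p) ?_
  have h1 := hf.2.trans_le (capacity_le_of_mem_closure (hT.lpGlue_mem_closure α hf.1 hh))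
  rw [enorm_rpow_split (α ≤ ·) f, enorm_lpGlue_rpow] at h1
  refine (ENNReal.add_le_add_iff_right (ne_top_of_le_ne_top ?_ (le_add_self.trans_eq
    (enorm_rpow_split (α ≤ ·) f).symm))).1 h1
  exact ENNReal.rpow_ne_top_of_nonneg (zero_lt_one.trans hp.out).le enorm_ne_top

theorem IsRootedTree.apply_le_gap (hT : IsRootedTree G o) (α : Edge G o)
    {f : EdgeLp (Edge G o) p} (hf : IsEquilibriumFunction Boundary.pred p E f) :
    f α ≤ max 0 (hT.gap α f) := by
  classical
  have h1 := hT.enorm_lpRestrict_le α hf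
    (single_mem_testFunctions α (hT.le_refl α) ((↑) ⁻¹' E : Set (tentBoundary α)))
  rw [enorm_le_iff_norm_le, norm_smul, lp.norm_single (by simpa using zero_lt_one.trans hp.out),
    norm_one, mul_one, Real.norm_of_nonneg (le_max_left _ _)] at h1
  exact (Real.le_norm_self _).trans
    ((norm_apply_le (lpRestrict (α ≤ ·) f) ⟨α, hT.le_refl α⟩).trans h1)

theorem IsRootedTree.potential_vertexPred_le_one (hT : IsRootedTree G o)
    {f : EdgeLp (Edge G o) p} (hf : IsEquilibriumFunction Boundary.pred p E f) (x : V) :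
    potential (vertexPred G o x) f ≤ 1 := by
  induction x using hT.vertex_induction with
  | root => simp [vertexPred_root, potential]
  | step β ih =>
    have hn := nonneg_of_mem_closure hf.1
    have hβ := hT.apply_le_gap β hf
    rw [hT.potential_eq_gap β hn, ENNReal.ofReal_le_one] at ih
    rw [max_eq_right (by linarith)] at hβ
    rw [hT.potential_vertexPred_e, hT.potential_eq_gap β hn,
      ← ENNReal.ofReal_add (hn β) (sub_nonneg.2 (hT.gap_le_one β hn)), ENNReal.ofReal_le_one]
    linarith

theorem IsRootedTree.potential_pred_le_one (hT : IsRootedTree G o)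
    {f : EdgeLp (Edge G o) p} (hf : IsEquilibriumFunction Boundary.pred p E f)
    (ζ : Boundary G o) : potential ζ.pred f ≤ 1 := by
  refine ENNReal.summable.tsum_le_of_sum_le fun F => ?_
  rcases F.eq_empty_or_nonempty with rfl | hF
  · simp
  -- Edges of one geodesic are totally ordered, so a finite set of them lies before its farthest
  -- member `γ`, and the vertex bound at `γ.e` applies.
  obtain ⟨γ, -, hγ⟩ := F.exists_max_image (fun β => G.dist o β.1.e) hF
  have hle : ∀ β ∈ F, β.1 ≤ γ.1 := by
    intro β hβ
    rcases hT.pred_total β.2 γ.2 with h | h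
    · exact h
    · have h' : γ.1 ∈ vertexPred G o β.1.e := h
      rw [hT.vertexPred_e] at h'
      rcases h' with h' | h'
      · rw [← h']
        exact hT.le_refl _
      · have h1 := hT.dist_e_le h'
        have h2 := hγ β hβ
        have h3 := β.1.outward
        omega
  refine le_trans ?_ (hT.potential_vertexPred_le_one hf γ.1.e)
  rw [potential, tsum_subtype (vertexPred G o γ.1.e) fun i => ENNReal.ofReal (f i)]
  have hs : ∀ β ∈ F, ENNReal.ofReal (f β.1) =
      (vertexPred G o γ.1.e).indicator (fun i => ENNReal.ofReal (f i)) β.1 := fun β hβ =>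
    (Set.indicator_of_mem (hle β hβ) fun i => ENNReal.ofReal (f i)).symm
  refine le_trans ?_ (ENNReal.sum_le_tsum (F.map (Function.Embedding.subtype _)))
  rw [Finset.sum_congr rfl hs, Finset.sum_map]
  rfl

end Gluing

/-! ### Equilibrium functions and measures of tents -/

section Equilibrium

variable {V : Type*} {G : SimpleGraph V} {o : V} {p : ℝ} [hp : Fact (1 < p)]
  {E : Set (Boundary G o)} {μ : Measure (Boundary G o)}

theorem IsRootedTree.potential_vertexPred_b_lt_one (hT : IsRootedTree G o) [IsFiniteMeasure μ]
    {f : EdgeLp (Edge G o) p} (hf : IsEquilibriumFunction Boundary.pred p E f)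
    (hfμ : ∀ i, f i = edgeFunction Boundary.pred p μ i) (α : Edge G o) :
    potential (vertexPred G o α.b) f < 1 := by
  have := hT.countable_edge
  have hn := nonneg_of_mem_closure hf.1
  have he : 0 < p.conjExponent - 1 := by
    have h0 : 0 < p - 1 := by linarith [hp.out]
    have : p.conjExponent - 1 = 1 / (p - 1) := by
      rw [Real.conjExponent]; field_simp; ring
    rw [this]
    positivity
  have hzero : ∀ i, f i = 0 ↔ μ (tentBoundary i) = 0 := fun i => by
    have hM : 0 ≤ copotential Boundary.pred μ i := measureReal_nonneg
    rw [hfμ, edgeFunction, Real.rpow_eq_zero hM he.ne']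
    exact measureReal_eq_zero_iff
  induction hx : α.b using hT.vertex_induction generalizing α with
  | root => simp [vertexPred_root, potential]
  | step β ih =>
    refine (hT.potential_vertexPred_le_one hf β.e).lt_of_ne fun h1 => ?_
    -- `If(β.e) = 1` while `If(β.b) < 1` by induction, so `f` jumps on `β`.
    have hβ : f β ≠ 0 := fun h0 => by
      have h2 := ih β rfl
      rw [hT.potential_vertexPred_e, h0, ENNReal.ofReal_zero, zero_add] at h1
      exact h2.ne h1
    refine hβ ((hzero β).2 ?_)
    -- Since `α` continues `β`, the tent boundary of `β` is covered by those of the successors.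
    -- There the gap is `0`, which forces `f`, hence the mass, to vanish.
    have hsub : tentBoundary β ⊆ ⋃ γ : {γ : Edge G o // γ.b = β.e}, tentBoundary γ.1 := by
      intro ζ hζ
      obtain ⟨γ, hγ, hb⟩ := hT.exists_next_mem_pred hx hζ
      exact Set.mem_iUnion.2 ⟨⟨γ, hb⟩, hγ⟩
    refine measure_mono_null hsub (measure_iUnion_null fun γ => (hzero γ.1).1 ?_)
    have h2 := hT.apply_le_gap γ.1 hf
    rw [← γ.2, hT.potential_eq_gap γ.1 hn] at h1
    have h3 : 1 - hT.gap γ.1 f = 1 := by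
      have := congrArg ENNReal.toReal h1
      rwa [ENNReal.toReal_ofReal (sub_nonneg.2 (hT.gap_le_one γ.1 hn)),
        ENNReal.toReal_one] at this
    rw [max_eq_left (by linarith)] at h2
    exact le_antisymm h2 (hn _)

/-- The integral of `If ≤ 1` against `μ` is the energy, which equals the finite total mass; equality
in the integrals forces equality almost everywhere. -/
theorem IsRootedTree.ae_potential_eq_one (hT : IsRootedTree G o) [IsFiniteMeasure μ]
    {f : EdgeLp (Edge G o) p} (hf : IsEquilibriumFunction Boundary.pred p E f)
    (hfμ : ∀ i, f i = edgeFunction Boundary.pred p μ i)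
    (mass : μ Set.univ = capacity Boundary.pred p E) :
    ∀ᵐ ζ ∂μ, potential ζ.pred f = 1 := by
  have := hT.countable_edge
  have h1 := enorm_rpow_eq_lintegral_potential measurableSet_tentBoundary μ hfμ
  rw [hf.2, ← mass] at h1
  refine ae_eq_of_ae_le_of_lintegral_le (g := fun _ => (1 : ℝ≥0∞))
    (Filter.Eventually.of_forall fun ζ => hT.potential_pred_le_one hf ζ) ?_
    aemeasurable_const ?_
  · rw [← h1]
    exact measure_ne_top _ _
  · rw [lintegral_one, h1]

/-- A test function `g` close to `f` still has positive gap, and on `E` inside the tent its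
potential beyond `b(α)` is at least that gap. Dividing by it gives a test function of the tent; then
let `g` tend to `f`. -/
theorem IsRootedTree.smul_lpRestrict_mem_closure (hT : IsRootedTree G o) (α : Edge G o)
    {f : EdgeLp (Edge G o) p} (hf : f ∈ closure (testFunctions Boundary.pred p E))
    (hgap : 0 < hT.gap α f) :
    (hT.gap α f)⁻¹ • lpRestrict (α ≤ ·) f ∈
      closure (testFunctions (tentPred α) p ((↑) ⁻¹' E : Set (tentBoundary α))) := by
  have hne := mem_closure_iff_nhdsWithin_neBot.1 hf
  have hc : ContinuousAt (fun f : EdgeLp (Edge G o) p =>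
      (hT.gap α f)⁻¹ • lpRestrict (α ≤ ·) f) f :=
    ((hT.continuous_gap α).continuousAt.inv₀ hgap.ne').smul
      (lpRestrict (α ≤ ·)).continuous.continuousAt
  refine mem_closure_of_tendsto (b := nhdsWithin f (testFunctions Boundary.pred p E))
    (hc.tendsto.mono_left nhdsWithin_le_nhds) ?_
  have hpos : ∀ᶠ g : EdgeLp (Edge G o) p in nhdsWithin f (testFunctions Boundary.pred p E),
      0 < hT.gap α g :=
    nhdsWithin_le_nhds ((hT.continuous_gap α).continuousAt.eventually (lt_mem_nhds hgap))
  filter_upwards [hpos, self_mem_nhdsWithin] with g hg0 hg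
  refine ⟨fun i => mul_nonneg (inv_nonneg.2 hg0.le) (hg.1 _), fun ζ hζ => ?_⟩
  have h1 := hg.2 ζ.1 hζ
  rw [hT.potential_pred_eq α ζ, hT.potential_eq_gap α hg.1] at h1
  change 1 ≤ potential (tentPred α ζ) fun β => (hT.gap α g)⁻¹ * g β.1
  rw [potential_const_mul (inv_nonneg.2 hg0.le), ENNReal.ofReal_inv_of_pos hg0]
  rw [mul_comm, ← div_eq_mul_inv, ENNReal.le_div_iff_mul_le (by simp [hg0]) (by simp), one_mul]
  have h2 : ENNReal.ofReal (1 - hT.gap α g) + ENNReal.ofReal (hT.gap α g) = 1 := by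
    rw [← ENNReal.ofReal_add (sub_nonneg.2 (hT.gap_le_one α hg.1)) hg0.le]
    simp
  rw [← h2] at h1
  exact (ENNReal.add_le_add_iff_left ENNReal.ofReal_ne_top).1 h1

theorem IsRootedTree.isEquilibriumFunction_smul_lpRestrict (hT : IsRootedTree G o)
    (α : Edge G o) {f : EdgeLp (Edge G o) p} (hf : IsEquilibriumFunction Boundary.pred p E f)
    (hgap : 0 < hT.gap α f) :
    IsEquilibriumFunction (tentPred α) p ((↑) ⁻¹' E : Set (tentBoundary α))
      ((hT.gap α f)⁻¹ • lpRestrict (α ≤ ·) f) := by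
  have hmem := hT.smul_lpRestrict_mem_closure α hf.1 hgap
  refine ⟨hmem, le_antisymm (le_iInf₂ fun h hh => ?_) (capacity_le_of_mem_closure hmem)⟩
  refine ENNReal.rpow_le_rpow ?_ (zero_lt_one.trans hp.out).le
  have h1 := hT.enorm_lpRestrict_le α hf hh
  rw [max_eq_right hgap.le, enorm_le_iff_norm_le, norm_smul, Real.norm_of_nonneg hgap.le] at h1
  rw [enorm_le_iff_norm_le, norm_smul, norm_inv, Real.norm_of_nonneg hgap.le,
    inv_mul_le_iff₀ hgap]
  exact h1

/-- As `p/p' = p - 1`, the constant is `gap^(-(p-1))`, and the power `p' - 1 = 1/(p-1)` turns it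
into `gap⁻¹`. -/
theorem IsRootedTree.edgeFunction_rescaledMeasure (hT : IsRootedTree G o) (α : Edge G o)
    {f : EdgeLp (Edge G o) p} (hn : ∀ i, 0 ≤ f i) (hgap : 0 < hT.gap α f)
    (hfμ : ∀ i, f i = edgeFunction Boundary.pred p μ i) (β : TentEdge α) :
    (hT.gap α f)⁻¹ * f β.1 = edgeFunction (tentPred α) p (rescaledMeasure p μ α) β := by
  have hμ : edgeFunction Boundary.pred p μ = f := funext fun i => (hfμ i).symm
  have hp0 : 0 < p := zero_lt_one.trans hp.out
  have h0 : 0 < p - 1 := by linarith [hp.out]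
  have he : p.conjExponent - 1 = 1 / (p - 1) := by
    rw [Real.conjExponent]; field_simp; ring
  have he' : p / p.conjExponent = p - 1 := by
    rw [Real.conjExponent]; field_simp
  have hset : (Subtype.val '' {ζ : tentBoundary α | β ∈ tentPred α ζ}) = tentBoundary β.1 := by
    ext ζ
    constructor
    · rintro ⟨ξ, hξ, rfl⟩
      exact hξ
    · exact fun hζ => ⟨⟨ζ, hT.tentBoundary_subset β.2 hζ⟩, hζ, rfl⟩
  have hM : copotential (tentPred α) (rescaledMeasure p μ α) β =
      (hT.gap α f ^ (p - 1))⁻¹ * copotential Boundary.pred μ β.1 := by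
    unfold copotential rescaledMeasure
    rw [measureReal_ennreal_smul_apply]
    congr 1
    · rw [rescalingConstant, potentialAtBeginning, hμ, hT.potential_eq_gap α hn, he',
        ENNReal.toReal_inv, ← ENNReal.toReal_rpow, ← ENNReal.ofReal_one,
        ← ENNReal.ofReal_sub _ (sub_nonneg.2 (hT.gap_le_one α hn)), sub_sub_cancel,
        ENNReal.toReal_ofReal hgap.le]
    · rw [Measure.real, Measure.real,
        (MeasurableEmbedding.subtype_coe (measurableSet_tentBoundary α)).comap_apply, hset]
      rfl
  have hM0 : 0 ≤ copotential Boundary.pred μ β.1 := measureReal_nonneg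
  rw [hfμ, edgeFunction, edgeFunction, hM, Real.mul_rpow (by positivity) hM0]
  congr 1
  rw [Real.inv_rpow (by positivity), ← Real.rpow_mul hgap.le, he, mul_one_div_cancel h0.ne',
    Real.rpow_one]

theorem IsRootedTree.isEquilibriumMeasure_rescaledMeasure (hT : IsRootedTree G o)
    (h : IsEquilibriumMeasure Boundary.pred p E μ) (α : Edge G o)
    (hα : potentialAtBeginning p μ α < 1) :
    IsEquilibriumMeasure (tentPred α) p ((↑) ⁻¹' E : Set (tentBoundary α))
      (rescaledMeasure p μ α) := by
  have := h.finite
  have := hT.countable_edge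
  have hemb := MeasurableEmbedding.subtype_coe (measurableSet_tentBoundary α)
  obtain ⟨f, hf, hfμ⟩ := h.equilibrium
  have hn := nonneg_of_mem_closure hf.1
  have hμ : edgeFunction Boundary.pred p μ = f := funext fun i => (hfμ i).symm
  have hgap : 0 < hT.gap α f := by
    rw [potentialAtBeginning, hμ, hT.potential_eq_gap α hn, ENNReal.ofReal_lt_one] at hα
    linarith
  have hk : rescalingConstant p μ α ≠ ∞ := by
    have h0 : 0 ≤ p / p.conjExponent :=
      (div_pos (zero_lt_one.trans hp.out) (Real.HolderConjugate.conjExponent hp.out).symm.pos).le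
    refine ENNReal.inv_ne_top.2 fun h' => ?_
    rcases (ENNReal.rpow_eq_zero_iff.1 h') with h' | h'
    · exact (tsub_pos_of_lt hα).ne' h'.1
    · exact h'.2.not_ge h0
  have hcomap : IsFiniteMeasure (μ.comap ((↑) : tentBoundary α → Boundary G o)) := by
    refine ⟨?_⟩
    rw [hemb.comap_apply]
    exact measure_lt_top _ _
  have hfin : IsFiniteMeasure (rescaledMeasure p μ α) := Measure.smul_finite _ hk
  have heq := hT.isEquilibriumFunction_smul_lpRestrict α hf hgap
  have hedge : ∀ β, ((hT.gap α f)⁻¹ • lpRestrict (α ≤ ·) f : EdgeLp (TentEdge α) p) β =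
      edgeFunction (tentPred α) p (rescaledMeasure p μ α) β := fun β =>
    hT.edgeFunction_rescaledMeasure α hn hgap hfμ β
  refine ⟨hfin, ?_, ⟨_, heq, hedge⟩, ?_⟩
  -- The tent boundary is open, so closure in the subspace is the trace of the closure of `E`.
  · rw [rescaledMeasure, Measure.smul_apply, hemb.comap_apply,
      ← (isOpen_tentBoundary α).isOpenMap_subtype_val.preimage_closure_eq_closure_preimage
        continuous_subtype_val]
    have : μ ((↑) '' ((↑) ⁻¹' closure E : Set (tentBoundary α))ᶜ) = 0 :=
      measure_mono_null (by rintro _ ⟨ζ, hζ, rfl⟩; exact hζ) h.carried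
    rw [this, smul_zero]
  -- Capacity is the energy of the rescaled function, that is the integral of its potential, which
  -- is `gap⁻¹ * gap = 1` almost everywhere.
  · rw [← heq.2, enorm_rpow_eq_lintegral_potential (P := tentPred α)
      (fun β => measurable_subtype_coe (measurableSet_tentBoundary β.1)) _ hedge, ← lintegral_one]
    refine lintegral_congr_ae (Measure.ae_smul_measure ?_ _)
    have hae := ae_restrict_of_ae (s := tentBoundary α)
      (hT.ae_potential_eq_one hf hfμ h.mass)
    rw [ae_restrict_iff_subtype (measurableSet_tentBoundary α)] at hae
    filter_upwards [hae] with ζ hζ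
    change 1 = potential (tentPred α ζ) fun β => (hT.gap α f)⁻¹ * f β.1
    rw [potential_const_mul (inv_nonneg.2 hgap.le), ENNReal.ofReal_inv_of_pos hgap]
    have h2 : ENNReal.ofReal (1 - hT.gap α f) + ENNReal.ofReal (hT.gap α f) = 1 := by
      rw [← ENNReal.ofReal_add (sub_nonneg.2 (hT.gap_le_one α hn)) hgap.le]
      simp
    rw [hT.potential_pred_eq α ζ, hT.potential_eq_gap α hn, ← h2] at hζ
    rw [(ENNReal.add_right_inj ENNReal.ofReal_ne_top).1 hζ,
      ENNReal.inv_mul_cancel (by simp [hgap]) ENNReal.ofReal_ne_top]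

/-! ### Strict growth of capacity on a smaller tent -/

theorem IsRootedTree.capacity_lt_capacity_tent (hT : IsRootedTree G o)
    (hE : 0 < capacity Boundary.pred p E) {α : Edge G o} (hα : α.b ≠ o)
    (hEα : E ⊆ tentBoundary α) :
    capacity Boundary.pred p E <
      capacity (tentPred α) p ((↑) ⁻¹' E : Set (tentBoundary α)) := by
  classical
  have hp0 : 0 < p := zero_lt_one.trans hp.out
  have hp1 : 0 < p - 1 := by linarith [hp.out]
  set C := capacity (tentPred α) p ((↑) ⁻¹' E : Set (tentBoundary α)) with hC
  obtain ⟨β, hβ⟩ := hT.exists_edge_e_eq hα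
  have hβα : β ∈ vertexPred G o α.b := hβ ▸ hT.le_refl β
  have hC1 : C ≤ 1 := by
    refine (iInf₂_le _ (single_mem_testFunctions α (hT.le_refl α) _)).trans_eq ?_
    rw [enorm_rpow_eq_ofReal, lp.norm_single (by simpa using hp0)]
    simp
  -- The competitor is `a` on the edge `β` just before the tent and `(1 - a) h` inside. Taking `a <
  -- 1` keeps the factor nonzero when it is moved inside the infimum.
  have key : ∀ a : ℝ, 0 ≤ a → a < 1 → capacity Boundary.pred p E ≤
      ENNReal.ofReal ((1 - a) ^ p) * C + ENNReal.ofReal (a ^ p) := by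
    intro a ha0 ha1
    have hs : 0 ≤ 1 - a := sub_nonneg.2 ha1.le
    have hs' : 0 < 1 - a := sub_pos.2 ha1
    have hs0 : ENNReal.ofReal ((1 - a) ^ p) ≠ 0 := by
      rw [Ne, ENNReal.ofReal_eq_zero, not_le]
      positivity
    rw [hC]
    unfold capacity
    simp_rw [ENNReal.mul_iInf_of_ne hs0 ENNReal.ofReal_ne_top]
    rw [ENNReal.iInf₂_add]
    refine le_iInf₂ fun h hh => ?_
    set f : EdgeLp (Edge G o) p := lp.single (ENNReal.ofReal p) β a with hfdef
    have hf : ∀ i, 0 ≤ f i := fun i => by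
      rw [hfdef, lp.single_apply, Pi.single_apply]
      split_ifs
      exacts [ha0, le_rfl]
    have hg := hT.lpGlue_mem_testFunctions α hf (fun ζ hζ hζ' => absurd (hEα hζ) hζ') hh hs (by
      have h1 : ENNReal.ofReal a ≤ potential (vertexPred G o α.b) f := by
        simpa [hfdef] using ofReal_le_potential (f := f) hβα
      refine le_trans ?_ (add_le_add_left h1 _)
      rw [← ENNReal.ofReal_add ha0 hs]
      simp)
    refine (iInf₂_le _ hg).trans ?_
    rw [enorm_lpGlue_rpow]
    refine add_le_add (le_of_eq ?_) ?_
    · rw [enorm_smul, ENNReal.mul_rpow_of_nonneg _ _ hp0.le, enorm_rpow_eq_ofReal (1 - a),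
        Real.norm_of_nonneg hs]
    · refine (le_add_self.trans_eq (enorm_rpow_split (α ≤ ·) f).symm).trans_eq ?_
      rw [enorm_rpow_eq_ofReal, hfdef, lp.norm_single (by simpa using hp0),
        Real.norm_of_nonneg ha0]
  -- The case `a = 0` is the weak inequality.
  have hCpos : 0 < C := by
    have h1 := key 0 le_rfl zero_lt_one
    rw [Real.zero_rpow hp0.ne', ENNReal.ofReal_zero, add_zero, sub_zero, Real.one_rpow,
      ENNReal.ofReal_one, one_mul] at h1
    exact hE.trans_le h1
  have hCtop : C ≠ ∞ := ne_top_of_le_ne_top ENNReal.one_ne_top hC1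
  obtain ⟨c, hc0, hcC⟩ : ∃ c : ℝ, 0 ≤ c ∧ C = ENNReal.ofReal c :=
    ⟨C.toReal, ENNReal.toReal_nonneg, (ENNReal.ofReal_toReal hCtop).symm⟩
  rw [hcC, ENNReal.ofReal_pos] at hCpos
  rw [hcC, ENNReal.ofReal_le_one] at hC1
  -- Chosen so that `a^p = a * c / 2`. Since `(1 - a)^p ≤ 1 - a`, the bound in `key` is at most `c -
  -- a * c / 2 < c`; `c ≤ 1` ensures `a < 1`.
  set a := (c / 2) ^ (p - 1)⁻¹ with ha
  have ha0 : 0 < a := by positivity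
  have ha1' : a < 1 := Real.rpow_lt_one (by positivity) (by linarith) (by positivity)
  have ha1 : a ≤ 1 := ha1'.le
  have hap : a ^ p = a * (c / 2) := by
    have h1 : a ^ (p - 1) = c / 2 := by
      rw [ha, ← Real.rpow_mul (by positivity), inv_mul_cancel₀ hp1.ne', Real.rpow_one]
    rw [← h1, ← Real.rpow_one_add' ha0.le (by linarith)]
    congr 1
    ring
  have h1a : (1 - a) ^ p ≤ 1 - a := by
    simpa using Real.rpow_le_rpow_of_exponent_ge' (sub_nonneg.2 ha1) (by linarith) zero_le_one
      hp.out.le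
  refine (key a ha0.le ha1').trans_lt ?_
  rw [hcC, ← ENNReal.ofReal_mul (by have := sub_nonneg.2 ha1; positivity),
    ← ENNReal.ofReal_add (by have := sub_nonneg.2 ha1; positivity) (by positivity),
    ENNReal.ofReal_lt_ofReal_iff hCpos, hap]
  nlinarith [mul_le_mul_of_nonneg_right h1a hc0, mul_pos ha0 hCpos]

end Equilibrium

end

end TreeCapacity

theorem mainTheorem8 {V : Type*} (G : SimpleGraph V) (o : V)
    (hT : TreeCapacity.IsRootedTree G o) (p : ℝ) [Fact (1 < p)] :
    (∀ (E : Set (TreeCapacity.Boundary G o)) (μ : Measure (TreeCapacity.Boundary G o)),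
      TreeCapacity.IsEquilibriumMeasure TreeCapacity.Boundary.pred p E μ →
      ∀ α : TreeCapacity.Edge G o,
        TreeCapacity.potentialAtBeginning p μ α < 1 ∧
        TreeCapacity.IsEquilibriumMeasure (TreeCapacity.tentPred α) p
          ((↑) ⁻¹' E : Set (TreeCapacity.tentBoundary α))
          (TreeCapacity.rescaledMeasure p μ α) ∧
        (μ Eᶜ = 0 →
          μ.restrict (E ∩ TreeCapacity.tentBoundary α) =
            μ.restrict (TreeCapacity.tentBoundary α))) ∧
    (∀ E : Set (TreeCapacity.Boundary G o),
      0 < TreeCapacity.capacity TreeCapacity.Boundary.pred p E →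
      ∀ α : TreeCapacity.Edge G o, α.b ≠ o → E ⊆ TreeCapacity.tentBoundary α →
        TreeCapacity.capacity TreeCapacity.Boundary.pred p E <
          TreeCapacity.capacity (TreeCapacity.tentPred α) p
            ((↑) ⁻¹' E : Set (TreeCapacity.tentBoundary α))) := by
  refine ⟨fun E μ h α => ?_, fun E hE α hα hEα => hT.capacity_lt_capacity_tent hE hα hEα⟩
  have hlt : TreeCapacity.potentialAtBeginning p μ α < 1 := by
    have := h.finite
    obtain ⟨f, hf, hfμ⟩ := h.equilibrium
    have hμ : TreeCapacity.edgeFunction TreeCapacity.Boundary.pred p μ = f :=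
      funext fun i => (hfμ i).symm
    rw [TreeCapacity.potentialAtBeginning, hμ]
    exact hT.potential_vertexPred_b_lt_one hf hfμ α
  refine ⟨hlt, hT.isEquilibriumMeasure_rescaledMeasure h α hlt, fun hE => ?_⟩
  -- `E` need not be measurable: almost everywhere equality of the two sets suffices.
  refine Measure.restrict_congr_set ?_
  have hae : ∀ᵐ ζ ∂μ, ζ ∈ E := mem_ae_iff.2 hE
  filter_upwards [hae] with ζ hζ
  exact propext ⟨fun h' => h'.2, fun h' => ⟨hζ, h'⟩⟩
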